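/- Let $\mathrm{RE}$ be the family of recursively enumerable languages over finite alphabets, i.e. of the languages generated by type-0 (unrestricted) grammars. An insertion rule $(u,\alpha,v)_{ins}$ (resp. deletion rule $(u,\alpha,v)_{del}$), $\alpha\neq\lambda$, over an alphabet $V$ rewrites $x_1uvx_2$ to $x_1u\alpha vx_2$ (resp. $x_1u\alpha vx_2$ to $x_1uvx_2$). A graph-controlled insertion-deletion system with $k$ components consists of a finite alphabet $V$, a terminal alphabet $T\subseteq V$, a finite set $A\subseteq V^*$ of axioms, an initial and a final component $i_0,i_f\in\{1,\dots,k\}$, and a finite set $R$ of triples $(i,r,j)$ with $i,j\in\{1,\dots,k\}$ and $r$ an insertion or deletion rule over $V$. A configuration $(i,w)$, $w\in V^*$, passes to $(j,w')$ in one step if there is $(i,r,j)\in R$ such that $r$ rewrites $w$ to $w'$. The generated language consists of all $w\in T^*$ such that $(i_f,w)$ is reachable, in zero or more steps, from $(i_0,a)$ for some $a\in A$. No condition is imposed on the communication graph, which has the nodes $1,\dots,k$ and an edge from $i$ to $j$ whenever $R$ contains some $(i,r,j)$. Let $GCL_4(ins_1^{1,0},del_1^{1,0})$ be the family of languages generated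 by such systems with at most $4$ components in which every insertion and every deletion rule $(u,\alpha,v)$ satisfies $|\alpha|\le 1$, $|u|\le 1$ and $|v|=0$. Then $$GCL_4(ins_1^{1,0},del_1^{1,0})=\mathrm{RE},$$ that is, for every finite alphabet $T$, a language $L\subseteq T^*$ is generated by such a system with terminal alphabet $T$ if and only if it is recursively enumerable. -/

import Mathlib

/-! Type-0 grammars and the recursively enumerable languages over a finite alphabet `T`.
The symbols of a device with terminal alphabet `T` and set of non-terminals `N` form Mathlib's type
`Symbol T N`, the disjoint union of `T` and `N`. -/

/-- A type-0 (unrestricted) grammar with terminal alphabet `T`. The left-hand side of every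
production contains at least one non-terminal. -/
structure Type0Grammar (T : Type) where
  /-- the non-terminal symbols -/
  N : Type
  finite_N : Finite N
  /-- the start symbol -/
  start : N
  /-- the productions `lhs → rhs`, as pairs `(lhs, rhs)` -/
  productions : Set (List (Symbol T N) × List (Symbol T N))
  finite_productions : productions.Finite
  lhs_nonterminal : ∀ p ∈ productions, ∃ X : N, Symbol.nonterminal X ∈ p.1

namespace Type0Grammar

/-- One derivation step: a production is applied at some place of the sentential form. -/
def Derives {T : Type} (G : Type0Grammar T) (x y : List (Symbol T G.N)) : Prop :=
  ∃ p ∈ G.productions, ∃ x₁ x₂ : List (Symbol T G.N),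
    x = x₁ ++ p.1 ++ x₂ ∧ y = x₁ ++ p.2 ++ x₂

/-- The language of all terminal strings derivable from the start symbol. -/
def language {T : Type} (G : Type0Grammar T) : Language T :=
  { w | Relation.ReflTransGen G.Derives [Symbol.nonterminal G.start] (w.map Symbol.terminal) }

end Type0Grammar

/-- The recursively enumerable languages over the alphabet `T`: those generated by type-0
grammars. -/
def RE (T : Type) : Set (Language T) :=
  { L | ∃ G : Type0Grammar T, G.language = L }

/-! Insertion and deletion rules. -/

/-- The type of a rule: insertion or deletion. -/
inductive InsDelKind where
  | ins
  | del

/-- An insertion rule or deletion rule `(u, α, v)` over the alphabet `V`, where `α` is not the empty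
string. -/
structure InsDelRule (V : Type) where
  kind : InsDelKind
  /-- the left context `u` -/
  left : List V
  /-- the inserted or deleted string `α` -/
  str : List V
  /-- the right context `v` -/
  right : List V
  str_ne_nil : str ≠ []

namespace InsDelRule

/-- `r.Applies x y`: the string `y` is obtained from `x` by one application of the rule `r`. -/
def Applies {V : Type} (r : InsDelRule V) (x y : List V) : Prop :=
  ∃ x₁ x₂ : List V,
    match r.kind with
    | .ins => x = x₁ ++ r.left ++ r.right ++ x₂ ∧ y = x₁ ++ r.left ++ r.str ++ r.right ++ x₂
    | .del => x = x₁ ++ r.left ++ r.str ++ r.right ++ x₂ ∧ y = x₁ ++ r.left ++ r.right ++ x₂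

/-- The rule conforms to size `(n, m, m'; p, q, q')`: an insertion rule inserts at most `n` symbols
with left and right contexts of lengths at most `m` and `m'`, and a deletion rule deletes at most
`p` symbols with left and right contexts of lengths at most `q` and `q'`. -/
def SizeLE {V : Type} (r : InsDelRule V) (n m m' p q q' : ℕ) : Prop :=
  match r.kind with
  | .ins => r.str.length ≤ n ∧ r.left.length ≤ m ∧ r.right.length ≤ m'
  | .del => r.str.length ≤ p ∧ r.left.length ≤ q ∧ r.right.length ≤ q'

end InsDelRule

/-! Graph-controlled insertion-deletion systems. -/

/-- A graph-controlled insertion-deletion system with `k` components and terminal alphabet `T`; its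
alphabet is `Symbol T N`, where `N` is the set of symbols that are not terminal. A rule
`(i, r, j)` says that in component `i` the insertion or deletion rule `r` may be applied, the
resulting string being sent to component `j`. There is no restriction on the communication graph,
which has an edge from `i` to `j` whenever some rule `(i, r, j)` is present. -/
structure GCInsDelSystem (k : ℕ) (T : Type) where
  /-- the symbols that are not terminal -/
  N : Type
  finite_N : Finite N
  /-- the axioms -/
  axiomSet : Set (List (Symbol T N))
  finite_axiomSet : axiomSet.Finite
  /-- the initial component -/
  initial : Fin k
  /-- the final component -/
  final : Fin k
  /-- the rules `(i, r, j)` -/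
  rules : Set (Fin k × InsDelRule (Symbol T N) × Fin k)
  finite_rules : rules.Finite

namespace GCInsDelSystem

/-- A transition between configurations `(i, w)`, where `i` is the current component and `w` the
current string. -/
def Step {k : ℕ} {T : Type} (P : GCInsDelSystem k T)
    (c d : Fin k × List (Symbol T P.N)) : Prop :=
  ∃ r : InsDelRule (Symbol T P.N), (c.1, r, d.1) ∈ P.rules ∧ r.Applies c.2 d.2

/-- The generated language: all terminal strings that can appear in the final component when the
computation starts with an axiom in the initial component. -/
def language {k : ℕ} {T : Type} (P : GCInsDelSystem k T) : Language T :=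
  { w | ∃ a ∈ P.axiomSet,
      Relation.ReflTransGen P.Step (P.initial, a) (P.final, w.map Symbol.terminal) }

/-- All insertion and deletion rules have size at most `(n, m, m'; p, q, q')`. -/
def SizeLE {k : ℕ} {T : Type} (P : GCInsDelSystem k T) (n m m' p q q' : ℕ) : Prop :=
  ∀ t ∈ P.rules, t.2.1.SizeLE n m m' p q q'

end GCInsDelSystem

/-- `GCL T k n m m' p q q'` is the family of the languages over `T` generated by graph-controlled
insertion-deletion systems with at most `k` components and with insertion and deletion rules of
size at most `(n, m, m'; p, q, q')`. -/
def GCL (T : Type) (k n m m' p q q' : ℕ) : Set (Language T) :=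
  { L | ∃ k' ≤ k, ∃ P : GCInsDelSystem k' T, P.SizeLE n m m' p q q' ∧ P.language = L }

/-! A grammar simulates a system by letting a marker for the current component walk through the
string and fire rules where it stands.

Conversely, a left-context marker can delete or insert the symbol to its right, so `lhs → rhs` is a
program of one-symbol instructions carried by a marker. In component 0, `ready l` executes the first
instruction of `l`. The difficulty is to replace `ready l` by `ready l'`, with `l'` the rest of `l`,
at the same place, since markers have to be inserted without context. The deletion of the old marker
checks the position: component 1 guesses a place for `done l'`, and component 2 erases `ready l`
only directly to the right of it; then component 1 guesses a place for `ready l'`, and component 3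
erases `done l'` only directly to the right of that. Wrong guesses block with a marker left in the
string, so they yield no terminal word, even in the final component 3. Once the program is empty, a
new one may be loaded anywhere and the old marker is erased without context, which also moves the
marker.

Soundness is an invariant for each component (`SysForm.step`); completeness is
`exists_sysStep_of_generates`. -/

open Relation

/-! Embedding a symbol alphabet into one with additional non-terminals (markers). -/

instance Symbol.instFinite {T N : Type*} [Finite T] [Finite N] : Finite (Symbol T N) :=
  Finite.of_injective
    (fun s : Symbol T N => (match s with
      | .terminal t => Sum.inl t
      | .nonterminal n => Sum.inr n : T ⊕ N))
    (by rintro (a | a) (b | b) h <;> simp_all)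

namespace MarkedSymbol

variable {T N M : Type}

/-- The embedding of an alphabet into the alphabet extended by the markers `M`. -/
def emb (M : Type) : Symbol T N → Symbol T (N ⊕ M)
  | .terminal t => .terminal t
  | .nonterminal n => .nonterminal (.inl n)

/-- The marker `k` as a symbol. -/
def mark (k : M) : Symbol T (N ⊕ M) := .nonterminal (.inr k)

/-- The embedding of strings. -/
abbrev emap (M : Type) (x : List (Symbol T N)) : List (Symbol T (N ⊕ M)) := x.map (emb M)

theorem emb_injective : Function.Injective (emb M : Symbol T N → _) := by
  rintro (a | a) (b | b) h <;> simp_all [emb]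

theorem emap_inj {x y : List (Symbol T N)} : emap M x = emap M y ↔ x = y :=
  (List.map_injective_iff.2 emb_injective).eq_iff

theorem emb_ne_mark (s : Symbol T N) (k : M) : emb M s ≠ mark k := by
  cases s <;> simp [emb, mark]

theorem mark_inj {k k' : M} : (mark k : Symbol T (N ⊕ M)) = mark k' ↔ k = k' := by
  simp [mark]

theorem mark_notMem (k : M) (x : List (Symbol T N)) : mark k ∉ emap M x := by
  simp [emb_ne_mark]

theorem emap_terminal (w : List T) :
    emap M (w.map (Symbol.terminal : T → Symbol T N)) = w.map Symbol.terminal := by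
  simp [emb, Function.comp_def]

/-- A string with a single marker splits at a marker in only one way. -/
theorem split_unique {x₁ x₂ : List (Symbol T N)} {k k' : M} {y₁ y₂ : List (Symbol T (N ⊕ M))}
    (h : emap M x₁ ++ mark k :: emap M x₂ = y₁ ++ mark k' :: y₂) :
    k = k' ∧ y₁ = emap M x₁ ∧ y₂ = emap M x₂ := by
  have hk : k = k' := by
    have : (mark k' : Symbol T (N ⊕ M)) ∈ emap M x₁ ++ mark k :: emap M x₂ := by rw [h]; simp
    simp only [List.mem_append, List.mem_cons, mark_notMem, mark_inj, false_or, or_false] at this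
    exact this.symm
  subst hk
  have := (List.append_cons_inj_of_notMem (mark_notMem k x₁) (mark_notMem k x₂)).1 h
  tauto

/-- Tells which marker a deletion rule has found: an insertion leaves at most two candidates. -/
theorem mem_of_insert {x₁ x₂ : List (Symbol T N)} {k c k' : M} {a b : List (Symbol T (N ⊕ M))}
    (hab : a ++ b = emap M x₁ ++ mark k :: emap M x₂) (h : mark k' ∈ a ++ mark c :: b) :
    k' = k ∨ k' = c := by
  have : (mark k' : Symbol T (N ⊕ M)) = mark c ∨ mark k' ∈ a ++ b := by
    simp only [List.mem_append, List.mem_cons] at h ⊢; tauto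
  rw [hab] at this
  simp only [List.mem_append, List.mem_cons, mark_notMem, mark_inj, false_or, or_false] at this
  tauto

/-- Removing an inserted marker gives back the original string. -/
theorem insert_split {x₁ x₂ : List (Symbol T N)} {k c : M} {a b y₁ y₂ : List (Symbol T (N ⊕ M))}
    (hab : a ++ b = emap M x₁ ++ mark k :: emap M x₂) (hkc : k ≠ c)
    (h : a ++ mark c :: b = y₁ ++ mark c :: y₂) : y₁ = a ∧ y₂ = b := by
  have hn : (mark c : Symbol T (N ⊕ M)) ∉ a ++ b := by
    rw [hab]
    simp [emb_ne_mark, mark_inj, hkc.symm]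
  simp only [List.mem_append, not_or] at hn
  have := (List.append_cons_inj_of_notMem hn.1 hn.2).1 h
  tauto

/-- Removing the original marker moves it to the place of the inserted one. -/
theorem insert_erase {x₁ x₂ : List (Symbol T N)} {k c : M} {a b y₁ y₂ : List (Symbol T (N ⊕ M))}
    (hab : a ++ b = emap M x₁ ++ mark k :: emap M x₂) (hkc : k ≠ c)
    (h : a ++ mark c :: b = y₁ ++ mark k :: y₂) :
    ∃ z₁ z₂, z₁ ++ z₂ = x₁ ++ x₂ ∧ y₁ ++ y₂ = emap M z₁ ++ mark c :: emap M z₂ := by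
  rcases List.append_eq_append_iff.1 hab with ⟨d, hd, hb⟩ | ⟨d, ha, hd⟩
  · obtain ⟨z₁, z₂, rfl, rfl, rfl⟩ := List.map_eq_append_iff.1 hd
    refine ⟨z₁, z₂ ++ x₂, by simp, ?_⟩
    subst hb
    have := (List.append_cons_inj_of_notMem (x₂ := y₁) (z₂ := y₂) (a₂ := mark k)
      (x₁ := emap M z₁ ++ mark c :: emap M z₂) (z₁ := emap M x₂) (a₁ := mark k)
      (by simp [emb_ne_mark, mark_inj, hkc]) (by simp [emb_ne_mark])).1 (by simp [← h])
    simp [← this.1, ← this.2.2]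
  · rcases List.cons_eq_append_iff.1 hd with ⟨rfl, rfl⟩ | ⟨d, rfl, hd'⟩
    · refine ⟨x₁, x₂, rfl, ?_⟩
      simp only [List.append_nil] at ha
      subst ha
      have := (List.append_cons_inj_of_notMem (x₂ := y₁) (z₂ := y₂) (a₂ := mark k)
        (x₁ := emap M x₁ ++ [mark c]) (z₁ := emap M x₂) (a₁ := mark k)
        (by simp [emb_ne_mark, mark_inj, hkc]) (by simp [emb_ne_mark])).1 (by simp [← h])
      simp [← this.1, ← this.2.2]
    · obtain ⟨z₁, z₂, rfl, rfl, rfl⟩ := List.map_eq_append_iff.1 hd'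
      refine ⟨x₁ ++ z₁, z₂, by simp, ?_⟩
      subst ha
      have := (List.append_cons_inj_of_notMem (x₂ := y₁) (z₂ := y₂) (a₂ := mark k)
        (x₁ := emap M x₁) (z₁ := emap M z₁ ++ mark c :: emap M z₂) (a₁ := mark k)
        (by simp [emb_ne_mark]) (by simp [emb_ne_mark, mark_inj, hkc])).1 (by simp [← h])
      simp [← this.1, ← this.2.2]

/-- A marker can be moved anywhere by inserting a new one and removing the old one. -/
theorem exists_insert_erase {x₁ x₂ z₁ z₂ : List (Symbol T N)} (k c : M) (h : x₁ ++ x₂ = z₁ ++ z₂) :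
    ∃ a b y₁ y₂ : List (Symbol T (N ⊕ M)), a ++ b = emap M x₁ ++ mark k :: emap M x₂ ∧
      a ++ mark c :: b = y₁ ++ mark k :: y₂ ∧ y₁ ++ y₂ = emap M z₁ ++ mark c :: emap M z₂ := by
  rcases List.append_eq_append_iff.1 h with ⟨d, rfl, rfl⟩ | ⟨d, rfl, rfl⟩
  · exact ⟨emap M x₁ ++ mark k :: emap M d, emap M z₂, emap M x₁,
      emap M d ++ mark c :: emap M z₂, by simp⟩
  · exact ⟨emap M z₁, emap M d ++ mark k :: emap M x₂, emap M z₁ ++ mark c :: emap M d,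
      emap M x₂, by simp⟩

end MarkedSymbol

/-! ### Insertion and deletion rules as rewriting rules -/

namespace InsDelRule

variable {V : Type}

/-- The string a rule rewrites, contexts included. -/
def lhs (r : InsDelRule V) : List V :=
  match r.kind with
  | .ins => r.left ++ r.right
  | .del => r.left ++ r.str ++ r.right

/-- The result of the rewriting of `r.lhs`. -/
def rhs (r : InsDelRule V) : List V :=
  match r.kind with
  | .ins => r.left ++ r.str ++ r.right
  | .del => r.left ++ r.right

theorem applies_iff {r : InsDelRule V} {x y : List V} :
    r.Applies x y ↔ ∃ x₁ x₂, x = x₁ ++ r.lhs ++ x₂ ∧ y = x₁ ++ r.rhs ++ x₂ := by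
  obtain ⟨_ | _, u, a, v, h⟩ := r <;> simp [Applies, lhs, rhs]

theorem finite_sizeLE [Finite V] (n m m' p q q' : ℕ) :
    {r : InsDelRule V | r.SizeLE n m m' p q q'}.Finite := by
  -- A crude common bound for the lengths of all three strings of a rule.
  let l := n + m + m' + p + q + q'
  have hf := List.finite_length_le V l
  refine Set.Finite.of_finite_image
    (f := fun r : InsDelRule V => ((match r.kind with | .ins => true | .del => false : Bool),
      r.left, r.str, r.right))
    ((Set.finite_univ.prod (hf.prod (hf.prod hf))).subset ?_) ?_
  · rintro _ ⟨⟨_ | _, u, a, v, h⟩, hr, rfl⟩ <;> simp [SizeLE] at hr <;> simp [l] <;> omega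
  · rintro ⟨_ | _, u, a, v, h⟩ _ ⟨_ | _, u', a', v', h'⟩ _ hh <;> simp_all

/-- Insertion of one symbol. -/
def ins (u : List V) (a : V) : InsDelRule V := ⟨.ins, u, [a], [], by simp⟩

/-- Deletion of one symbol. -/
def del (u : List V) (a : V) : InsDelRule V := ⟨.del, u, [a], [], by simp⟩

theorem ins_applies {u : List V} {a : V} {x y : List V} :
    (ins u a).Applies x y ↔ ∃ x₁ x₂, x = x₁ ++ (u ++ x₂) ∧ y = x₁ ++ (u ++ a :: x₂) := by
  simp [Applies, ins]

theorem del_applies {u : List V} {a : V} {x y : List V} :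
    (del u a).Applies x y ↔ ∃ x₁ x₂, x = x₁ ++ (u ++ a :: x₂) ∧ y = x₁ ++ (u ++ x₂) := by
  simp [Applies, del]

end InsDelRule

/-! Simulation of graph-controlled insertion-deletion systems by type-0 grammars: a marker for the
current component walks through the string, and rules are applied next to it. -/

namespace GCInsDelSystem

open MarkedSymbol

variable {k : ℕ} {T : Type} (P : GCInsDelSystem k T)

/-- The productions of the simulating grammar; the marker `none` is the start symbol. -/
inductive GrammarProduction :
    List (Symbol T (P.N ⊕ Option (Fin k))) × List (Symbol T (P.N ⊕ Option (Fin k))) → Prop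
  | start {a} (ha : a ∈ P.axiomSet) :
      GrammarProduction ([mark none], mark (some P.initial) :: emap _ a)
  | right (i x) : GrammarProduction ([mark (some i), emb _ x], [emb _ x, mark (some i)])
  | left (i x) : GrammarProduction ([emb _ x, mark (some i)], [mark (some i), emb _ x])
  | rule {i r j} (h : (i, r, j) ∈ P.rules) :
      GrammarProduction (mark (some i) :: emap _ r.lhs, mark (some j) :: emap _ r.rhs)
  | halt : GrammarProduction ([mark (some P.final)], [])

theorem finite_grammarProduction [Finite T] : {p | P.GrammarProduction p}.Finite := by
  have := P.finite_N
  have h₁ := P.finite_axiomSet.image fun a =>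
    (([mark none], mark (some P.initial) :: emap _ a) :
      List (Symbol T (P.N ⊕ Option (Fin k))) × List (Symbol T (P.N ⊕ Option (Fin k))))
  have h₂ := Set.finite_range fun q : Fin k × Symbol T P.N =>
    (([mark (some q.1), emb _ q.2], [emb _ q.2, mark (some q.1)]) :
      List (Symbol T (P.N ⊕ Option (Fin k))) × List (Symbol T (P.N ⊕ Option (Fin k))))
  have h₃ := Set.finite_range fun q : Fin k × Symbol T P.N =>
    (([emb _ q.2, mark (some q.1)], [mark (some q.1), emb _ q.2]) :
      List (Symbol T (P.N ⊕ Option (Fin k))) × List (Symbol T (P.N ⊕ Option (Fin k))))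
  have h₄ := P.finite_rules.image fun t =>
    ((mark (some t.1) :: emap _ t.2.1.lhs, mark (some t.2.2) :: emap _ t.2.1.rhs) :
      List (Symbol T (P.N ⊕ Option (Fin k))) × List (Symbol T (P.N ⊕ Option (Fin k))))
  have h₅ := Set.finite_singleton (([mark (some P.final)], []) :
      List (Symbol T (P.N ⊕ Option (Fin k))) × List (Symbol T (P.N ⊕ Option (Fin k))))
  refine ((((h₁.union h₂).union h₃).union h₄).union h₅).subset ?_
  rintro _ (ha | ⟨i, x⟩ | ⟨i, x⟩ | h | _)
  · exact .inl (.inl (.inl (.inl ⟨_, ha, rfl⟩)))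
  · exact .inl (.inl (.inl (.inr ⟨(i, x), rfl⟩)))
  · exact .inl (.inl (.inr ⟨(i, x), rfl⟩))
  · exact .inl (.inr ⟨_, h, rfl⟩)
  · exact .inr rfl

/-- The type-0 grammar simulating `P`. -/
def toGrammar [Finite T] : Type0Grammar T where
  N := P.N ⊕ Option (Fin k)
  finite_N := by have := P.finite_N; infer_instance
  start := .inr none
  productions := {p | P.GrammarProduction p}
  finite_productions := P.finite_grammarProduction
  lhs_nonterminal := by
    rintro _ (ha | ⟨i, x⟩ | ⟨i, x⟩ | @⟨i, r, j, h⟩ | _)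
    · exact ⟨.inr none, by simp [mark]⟩
    · exact ⟨.inr (some i), by simp [mark]⟩
    · exact ⟨.inr (some i), by simp [mark]⟩
    · exact ⟨.inr (some i), by simp [mark]⟩
    · exact ⟨.inr (some P.final), by simp [mark]⟩

/-- A derivation step of the simulating grammar. -/
def GrammarStep (s s' : List (Symbol T (P.N ⊕ Option (Fin k)))) : Prop :=
  ∃ p, P.GrammarProduction p ∧ ∃ y₁ y₂, s = y₁ ++ p.1 ++ y₂ ∧ s' = y₁ ++ p.2 ++ y₂

/-- The sentential forms of the simulating grammar. -/
inductive GrammarForm : List (Symbol T (P.N ⊕ Option (Fin k))) → Prop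
  | start : GrammarForm [mark none]
  | run {a i x₁ x₂} (ha : a ∈ P.axiomSet)
      (h : ReflTransGen P.Step (P.initial, a) (i, x₁ ++ x₂)) :
      GrammarForm (emap _ x₁ ++ mark (some i) :: emap _ x₂)
  | halt {a x} (ha : a ∈ P.axiomSet) (h : ReflTransGen P.Step (P.initial, a) (P.final, x)) :
      GrammarForm (emap _ x)

/-- The single marker determines where a production applies, so each production either moves the
marker, performs one genuine step of `P`, or starts or ends the run. -/
theorem GrammarForm.step {s s'} (hs : P.GrammarForm s)
    (h : P.GrammarStep s s') : P.GrammarForm s' := by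
  obtain ⟨p, hp, y₁, y₂, rfl, rfl⟩ := h
  generalize hq : y₁ ++ p.1 ++ y₂ = s at hs
  -- Every left-hand side contains a marker, so nothing can happen after halting.
  have hm : ∃ i, mark i ∈ s := by
    subst hq
    cases hp with
    | start ha => exact ⟨none, by simp⟩
    | right i x => exact ⟨some i, by simp⟩
    | left i x => exact ⟨some i, by simp⟩
    | @rule i r j h => exact ⟨some i, by simp⟩
    | halt => exact ⟨some P.final, by simp⟩
  cases hs with
  | halt ha h => obtain ⟨i, hi⟩ := hm; exact absurd hi (mark_notMem _ _)
  | start =>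
    have hx (x : List (Symbol T (P.N ⊕ Option (Fin k)))) (i y) (h : x ++ mark i :: y = [mark none]) :
        i = none ∧ x = [] ∧ y = [] := by
      rcases List.append_eq_singleton_iff.1 h with h | h <;> simp_all [mark_inj]
    cases hp with
    | @start a ha =>
      obtain ⟨-, rfl, rfl⟩ := hx y₁ none y₂ (by simpa using hq)
      simpa using GrammarForm.run (P := P) (x₁ := []) (x₂ := a) ha .refl
    | right i x => exact absurd (hx y₁ _ (_ :: y₂) (by simpa using hq)).1 (by simp)
    | left i x => exact absurd (hx (y₁ ++ [_]) _ y₂ (by simpa using hq)).1 (by simp)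
    | @rule i r j h => exact absurd (hx y₁ _ (_ ++ y₂) (by simpa using hq)).1 (by simp)
    | halt => exact absurd (hx y₁ _ y₂ (by simpa using hq)).1 (by simp)
  | @run a i' x₁ x₂ ha h =>
    have key {z₁ z₂ i} (hz : y₁ ++ p.1 ++ y₂ = z₁ ++ mark i :: z₂) :=
      split_unique (hq.symm.trans hz)
    cases hp with
    | start ha =>
      obtain ⟨hi, -⟩ := key (z₁ := y₁) (z₂ := y₂) (i := none) (by simp)
      cases hi
    | right i x =>
      obtain ⟨hi, rfl, h₂⟩ := key (z₁ := y₁) (z₂ := _ :: y₂) (i := some i) (by simp; rfl)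
      cases hi
      obtain ⟨x', x₂, rfl, hx, rfl⟩ := List.map_eq_cons_iff.1 h₂.symm
      simpa [hx] using GrammarForm.run (P := P) (x₁ := x₁ ++ [x']) (x₂ := x₂) ha (by simpa using h)
    | left i x =>
      obtain ⟨hi, h₁, rfl⟩ := key (z₁ := y₁ ++ [_]) (z₂ := y₂) (i := some i) (by simp; rfl)
      cases hi
      obtain ⟨x₁, _, rfl, rfl, hx'⟩ := List.map_eq_append_iff.1 h₁.symm
      obtain ⟨x', _, rfl, hx, hl⟩ := List.map_eq_cons_iff.1 hx'
      obtain rfl := List.map_eq_nil_iff.1 hl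
      obtain rfl := emb_injective hx
      simpa using GrammarForm.run (P := P) (x₁ := x₁) (x₂ := x' :: x₂) ha (by simpa using h)
    | @rule i r j hr =>
      obtain ⟨hi, rfl, h₂⟩ := key (z₁ := y₁) (z₂ := _ ++ y₂) (i := some i) (by simp; rfl)
      cases hi
      obtain ⟨l, x₂, rfl, hl, rfl⟩ := List.map_eq_append_iff.1 h₂.symm
      obtain rfl := emap_inj.1 hl
      have := GrammarForm.run (P := P) (x₁ := x₁) (x₂ := r.rhs ++ x₂) ha
        (h.tail ⟨r, hr, InsDelRule.applies_iff.2 ⟨x₁, x₂, by simp, by simp⟩⟩)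
      simpa using this
    | halt =>
      obtain ⟨hi, rfl, rfl⟩ := key (z₁ := y₁) (z₂ := y₂) (i := some P.final) (by simp)
      cases hi
      simpa using GrammarForm.halt (P := P) ha h

theorem grammarStep_of_production {p} (hp : P.GrammarProduction p)
    {s s' : List (Symbol T (P.N ⊕ Option (Fin k)))} (y₁ y₂)
    (h : s = y₁ ++ p.1 ++ y₂) (h' : s' = y₁ ++ p.2 ++ y₂) : P.GrammarStep s s' :=
  ⟨p, hp, y₁, y₂, h, h'⟩

theorem grammarStep_move {i : Fin k} {x₁ x₂ z₁ z₂ : List (Symbol T P.N)} (h : x₁ ++ x₂ = z₁ ++ z₂) :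
    ReflTransGen P.GrammarStep (emap _ x₁ ++ mark (some i) :: emap _ x₂)
      (emap _ z₁ ++ mark (some i) :: emap _ z₂) := by
  have right (u v w : List (Symbol T P.N)) :
      ReflTransGen P.GrammarStep (emap _ u ++ mark (some i) :: emap _ (v ++ w))
        (emap _ (u ++ v) ++ mark (some i) :: emap _ w) := by
    induction v generalizing u with
    | nil => simpa using ReflTransGen.refl
    | cons x v ih =>
      refine .head (P.grammarStep_of_production (.right i x) (emap _ u) (emap _ (v ++ w)) (by simp) rfl) ?_
      simpa using ih (u ++ [x])
  have left (u v w : List (Symbol T P.N)) :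
      ReflTransGen P.GrammarStep (emap _ (u ++ v) ++ mark (some i) :: emap _ w)
        (emap _ u ++ mark (some i) :: emap _ (v ++ w)) := by
    induction v generalizing u with
    | nil => simpa using ReflTransGen.refl
    | cons x v ih =>
      refine .tail (b := emap _ (u ++ [x]) ++ mark (some i) :: emap _ (v ++ w)) ?_
        (P.grammarStep_of_production (.left i x) (emap _ u) (emap _ (v ++ w)) (by simp) (by simp))
      simpa using ih (u ++ [x])
  -- The marker goes to the left end, then right to its target.
  have h₁ := left [] x₁ x₂
  rw [h] at h₁
  exact (by simpa using h₁ : ReflTransGen P.GrammarStep _ _).trans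
    (by simpa using right [] z₁ z₂)

theorem grammarStep_of_reach {a : List (Symbol T P.N)} (ha : a ∈ P.axiomSet) {c}
    (h : ReflTransGen P.Step (P.initial, a) c) :
    ReflTransGen P.GrammarStep [mark none]
      (mark (some c.1) :: emap _ c.2) := by
  induction h with
  | refl => exact .single (P.grammarStep_of_production (.start ha) [] [] rfl (by simp))
  | @tail c d _ hs ih =>
    obtain ⟨r, hr, happ⟩ := hs
    obtain ⟨x₁, x₂, h₁, h₂⟩ := InsDelRule.applies_iff.1 happ
    refine (ih.trans (P.grammarStep_move (x₁ := []) (z₁ := x₁) (z₂ := r.lhs ++ x₂)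
      (by simp [h₁]))).trans (.head (P.grammarStep_of_production (.rule hr) (emap _ x₁) (emap _ x₂)
      (by simp) rfl) ?_)
    have := P.grammarStep_move (i := d.1) (x₁ := x₁) (x₂ := r.rhs ++ x₂) (z₁ := []) (z₂ := d.2)
      (by simp [h₂])
    simpa using this

theorem toGrammar_language [Finite T] : P.toGrammar.language = P.language := by
  ext w
  change ReflTransGen P.GrammarStep [mark none] (w.map Symbol.terminal) ↔ _
  constructor
  · intro h
    have key {s} (h : ReflTransGen P.GrammarStep [mark none] s) : P.GrammarForm s := by
      induction h with
      | refl => exact .start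
      | tail _ h ih => exact ih.step P h
    have := key h
    generalize hs : (w.map Symbol.terminal : List (Symbol T (P.N ⊕ Option (Fin k)))) = s at this
    rw [← emap_terminal (N := P.N)] at hs
    cases this with
    | start => exact absurd (by simp) (hs ▸ mark_notMem none _ : mark none ∉ [mark none])
    | @run a i x₁ x₂ ha h =>
      exact absurd (by simp) (hs ▸ mark_notMem (some i) _ :
        mark (some i) ∉ emap _ x₁ ++ mark (some i) :: emap _ x₂)
    | @halt a x ha h =>
      obtain rfl := emap_inj.1 hs
      exact ⟨a, ha, h⟩
  · rintro ⟨a, ha, h⟩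
    refine (P.grammarStep_of_reach ha h).tail (P.grammarStep_of_production .halt [] (w.map Symbol.terminal)
      ?_ rfl)
    rw [← emap_terminal (N := P.N)]; rfl

end GCInsDelSystem

theorem GCL_subset_RE (T : Type) [Finite T] (k n m m' p q q' : ℕ) :
    GCL T k n m m' p q q' ⊆ RE T := by
  rintro _ ⟨_, _, P, _, rfl⟩
  exact ⟨P.toGrammar, P.toGrammar_language⟩

/-! Simulation of type-0 grammars by graph-controlled insertion-deletion systems with four
components: a production is turned into a program of deletions and insertions, and a marker that
carries the rest of the program executes it. -/

namespace Type0Grammar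

open MarkedSymbol InsDelRule

/-! ### Productions as programs of single-symbol instructions -/

section Programs

variable {S : Type}

/-- The program of a production: delete its left-hand side from left to right, then insert its
right-hand side from right to left. -/
def program (p : List S × List S) : List (InsDelKind × S) :=
  p.1.map (Prod.mk .del) ++ p.2.reverse.map (Prod.mk .ins)

/-- Execution of a program at the beginning of a string. -/
inductive Run : List (InsDelKind × S) → List S → List S → Prop
  | nil (x) : Run [] x x
  | del {a ops x y} (h : Run ops x y) : Run ((.del, a) :: ops) (a :: x) y
  | ins {a ops x y} (h : Run ops (a :: x) y) : Run ((.ins, a) :: ops) x y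

theorem run_del_append {l : List S} {ops x y} :
    Run (l.map (Prod.mk .del) ++ ops) x y ↔ ∃ z, x = l ++ z ∧ Run ops z y := by
  induction l generalizing x with
  | nil => simp
  | cons a l ih =>
    constructor
    · rintro (_ | h)
      obtain ⟨z, rfl, hz⟩ := ih.1 h
      exact ⟨z, rfl, hz⟩
    · rintro ⟨z, rfl, hz⟩
      exact .del (ih.2 ⟨z, rfl, hz⟩)

theorem run_ins {l : List S} {x y} : Run (l.map (Prod.mk .ins)) x y ↔ y = l.reverse ++ x := by
  induction l generalizing x with
  | nil =>
    constructor
    · rintro ⟨⟩; rfl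
    · rintro rfl; exact .nil _
  | cons a l ih =>
    constructor
    · rintro (_ | _ | h)
      simpa using ih.1 h
    · rintro rfl
      exact .ins (ih.2 (by simp))

/-- Each insertion lands directly at the marker, in front of the earlier ones; inserting `p.2` from
its last symbol on therefore restores its order. -/
theorem run_program {p : List S × List S} {x y} :
    Run (program p) x y ↔ ∃ z, x = p.1 ++ z ∧ y = p.2 ++ z := by
  simp [program, run_del_append, run_ins, -List.map_reverse]

end Programs

/-- Markers with programs in `Q`: a marker `ready l` executes the first instruction of `l`, and a
marker `done l` is left with `l` to be executed. -/
inductive Marker (Q : Type)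
  | ready (l : Q)
  | done (l : Q)

instance {Q : Type} [Finite Q] : Finite (Marker Q) :=
  Finite.of_injective
    (fun s : Marker Q => (match s with
      | .ready l => Sum.inl l
      | .done l => Sum.inr l : Q ⊕ Q))
    (by rintro (a | a) (b | b) h <;> simp_all)

variable {T : Type} (G : Type0Grammar T)

/-- The remainders of the programs of the productions. -/
def Remainder : Type :=
  {l : List (InsDelKind × Symbol T G.N) // l = [] ∨ ∃ p ∈ G.productions, l <:+ program p}

instance : Finite G.Remainder := by
  refine Set.Finite.to_subtype (Set.Finite.subset (s := {[]} ∪ ⋃ p ∈ G.productions,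
    {l | l ∈ (program p).tails}) ?_ ?_)
  · exact (Set.finite_singleton _).union
      (G.finite_productions.biUnion fun p _ => List.finite_toSet _)
  · rintro l (rfl | ⟨p, hp, hl⟩)
    · exact .inl rfl
    · exact .inr (Set.mem_biUnion hp (by simpa using hl))

/-- The empty program. -/
def Remainder.empty : G.Remainder := ⟨[], .inl rfl⟩

/-- The alphabet of the simulating system. -/
abbrev SysSymbol : Type := Symbol T (G.N ⊕ Marker G.Remainder)

open Marker

/-- The rules of the simulating system. -/
inductive SysRule : Fin 4 → InsDelRule G.SysSymbol → Fin 4 → Prop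
  | insert {l l' : G.Remainder} {a} (h : l.1 = (.ins, a) :: l'.1) :
      SysRule 0 (ins [mark (ready l)] (emb _ a)) 1
  | delete {l l' : G.Remainder} {a} (h : l.1 = (.del, a) :: l'.1) :
      SysRule 0 (del [mark (ready l)] (emb _ a)) 1
  | finish (l) : SysRule 1 (ins [] (mark (done l))) 2
  | clearReady {l l' : G.Remainder} {o} (h : l.1 = o :: l'.1) :
      SysRule 2 (del [mark (done l')] (mark (ready l))) 1
  | next (l) : SysRule 1 (ins [] (mark (ready l))) 3
  | clearDone (l) : SysRule 3 (del [mark (ready l)] (mark (done l))) 0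
  | load {l : G.Remainder} {p} (hp : p ∈ G.productions) (h : l.1 = program p) :
      SysRule 0 (ins [] (mark (ready l))) 2
  | unload {l : G.Remainder} (h : l.1 = []) : SysRule 2 (del [] (mark (ready l))) 0
  | halt {l : G.Remainder} (h : l.1 = []) : SysRule 0 (del [] (mark (ready l))) 3

variable {G} in
theorem SysRule.sizeLE {i r j} (h : G.SysRule i r j) : r.SizeLE 1 1 0 1 1 0 := by
  cases h <;> simp [InsDelRule.SizeLE, ins, del]

/-- The graph-controlled insertion-deletion system simulating `G`. -/
def toGC [Finite T] : GCInsDelSystem 4 T where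
  N := G.N ⊕ Marker G.Remainder
  finite_N := by have := G.finite_N; infer_instance
  axiomSet := {[mark (ready (Remainder.empty G)), emb _ (.nonterminal G.start)]}
  finite_axiomSet := Set.finite_singleton _
  initial := 0
  final := 3
  rules := {t | G.SysRule t.1 t.2.1 t.2.2}
  finite_rules := by
    have := G.finite_N
    exact (Set.finite_univ.prod ((finite_sizeLE 1 1 0 1 1 0).prod Set.finite_univ)).subset
      fun t ht => ⟨trivial, ht.sizeLE, trivial⟩

/-- A computation step of the simulating system. -/
def SysStep (c d : Fin 4 × List G.SysSymbol) : Prop :=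
  ∃ r, G.SysRule c.1 r d.1 ∧ r.Applies c.2 d.2

/-- Derivability from the start symbol. -/
abbrev Generates (x : List (Symbol T G.N)) : Prop :=
  ReflTransGen G.Derives [.nonterminal G.start] x

/-- The program to be executed at a marker whose first instruction, if any, has been executed. -/
inductive Pending : Marker G.Remainder → List (InsDelKind × Symbol T G.N) → Prop
  | ready {l : G.Remainder} {o ops} (h : l.1 = o :: ops) : Pending (ready l) ops
  | done (l : G.Remainder) : Pending (done l) l.1

/-- The strings in component 0. -/
inductive ReadyForm : List G.SysSymbol → Prop
  | mk {l : G.Remainder} {x₁ x₂} (h : ∀ y, Run l.1 x₂ y → G.Generates (x₁ ++ y)) :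
      ReadyForm (emap _ x₁ ++ mark (ready l) :: emap _ x₂)

/-- The strings in component 1. -/
inductive PendingForm : List G.SysSymbol → Prop
  | mk {k ops x₁ x₂} (hk : G.Pending k ops) (h : ∀ y, Run ops x₂ y → G.Generates (x₁ ++ y)) :
      PendingForm (emap _ x₁ ++ mark k :: emap _ x₂)

/-- The strings in component 2. -/
inductive ReadyClearForm : List G.SysSymbol → Prop
  | finish {a b} (l) (h : G.PendingForm (a ++ b)) : ReadyClearForm (a ++ mark (done l) :: b)
  | load {a b} {l : G.Remainder} {p} (hp : p ∈ G.productions) (hl : l.1 = program p)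
      (h : G.ReadyForm (a ++ b)) : ReadyClearForm (a ++ mark (ready l) :: b)

/-- The strings in component 3. -/
inductive DoneClearForm : List G.SysSymbol → Prop
  | next {a b} (l) (h : G.PendingForm (a ++ b)) : DoneClearForm (a ++ mark (ready l) :: b)
  | halt {x} (h : G.Generates x) : DoneClearForm (emap _ x)

/-- The strings in each component. -/
def SysForm : Fin 4 → List G.SysSymbol → Prop
  | 0 => G.ReadyForm
  | 1 => G.PendingForm
  | 2 => G.ReadyClearForm
  | 3 => G.DoneClearForm

/-! ### Soundness: invariants of the four components -/

variable {G}

/-- Keeps a freshly loaded marker distinct from one whose program is finished, so that `unload`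
cannot erase the wrong one. -/
theorem program_ne_nil {p} (hp : p ∈ G.productions) : program p ≠ [] := by
  obtain ⟨X, hX⟩ := G.lhs_nonterminal p hp
  have : p.1 ≠ [] := List.ne_nil_of_mem hX
  simp [program, this]

theorem ReadyForm.insert {l l' : G.Remainder} {a y₁ y₂} (hl : l.1 = (.ins, a) :: l'.1)
    (h : G.ReadyForm (y₁ ++ mark (ready l) :: y₂)) :
    G.PendingForm (y₁ ++ mark (ready l) :: emb _ a :: y₂) := by
  generalize hs : y₁ ++ mark (ready l) :: y₂ = s at h
  obtain @⟨l₀, x₁, x₂, h⟩ := h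
  obtain ⟨hk, rfl, rfl⟩ := split_unique hs.symm
  cases hk
  exact .mk (x₂ := a :: x₂) (.ready hl) fun y hy => h y (by rw [hl]; exact .ins hy)

theorem ReadyForm.delete {l l' : G.Remainder} {a y₁ y₂} (hl : l.1 = (.del, a) :: l'.1)
    (h : G.ReadyForm (y₁ ++ mark (ready l) :: emb _ a :: y₂)) :
    G.PendingForm (y₁ ++ mark (ready l) :: y₂) := by
  generalize hs : y₁ ++ mark (ready l) :: emb _ a :: y₂ = s at h
  obtain @⟨l₀, x₁, x₂, h⟩ := h
  obtain ⟨hk, rfl, h₂⟩ := split_unique hs.symm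
  cases hk
  obtain ⟨a', x₂, rfl, ha, rfl⟩ := List.map_eq_cons_iff.1 h₂.symm
  obtain rfl := emb_injective ha
  exact .mk (.ready hl) fun y hy => h y (by rw [hl]; exact .del hy)

theorem ReadyForm.halt {l : G.Remainder} {y₁ y₂} (hl : l.1 = [])
    (h : G.ReadyForm (y₁ ++ mark (ready l) :: y₂)) : G.DoneClearForm (y₁ ++ y₂) := by
  generalize hs : y₁ ++ mark (ready l) :: y₂ = s at h
  obtain @⟨l₀, x₁, x₂, h⟩ := h
  obtain ⟨hk, rfl, rfl⟩ := split_unique hs.symm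
  cases hk
  rw [← List.map_append]
  exact .halt (h _ (by rw [hl]; exact .nil x₂))

/-- Adjacency forces `done l'` to stand exactly where `ready l` stood, so the split of the string is
unchanged and the pending instructions become those of `l'`. -/
theorem ReadyClearForm.clearReady {l l' : G.Remainder} {o y₁ y₂} (hl : l.1 = o :: l'.1)
    (h : G.ReadyClearForm (y₁ ++ mark (done l') :: mark (ready l) :: y₂)) :
    G.PendingForm (y₁ ++ mark (done l') :: y₂) := by
  generalize hs : y₁ ++ mark (done l') :: mark (ready l) :: y₂ = s at h
  cases h with
  | @finish a b l₀ h =>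
    generalize hab : a ++ b = t at h
    obtain @⟨k, ops, x₁, x₂, hk, h⟩ := h
    have h₁ := mem_of_insert (k' := ready l) hab (by rw [← hs]; simp)
    have h₂ := mem_of_insert (k' := done l') hab (by rw [← hs]; simp)
    obtain rfl : k = ready l := by simpa [eq_comm] using h₁
    obtain rfl : l' = l₀ := by simpa using h₂
    obtain ⟨rfl, rfl⟩ := insert_split hab (by simp) hs.symm
    obtain ⟨-, rfl, rfl⟩ := split_unique hab.symm
    cases hk with
    | ready h' =>
      obtain ⟨-, rfl⟩ := List.cons.inj (hl.symm.trans h')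
      exact .mk (.done l') h
  | @load a b l₀ p hp hl₀ h =>
    generalize hab : a ++ b = t at h
    obtain @⟨l₁, x₁, x₂, h⟩ := h
    -- After a load both markers are of the form `ready`, so no `done l'` is available.
    have h₂ := mem_of_insert (k' := done l') hab (by rw [← hs]; simp)
    simp at h₂

theorem ReadyClearForm.unload {l : G.Remainder} {y₁ y₂} (hl : l.1 = [])
    (h : G.ReadyClearForm (y₁ ++ mark (ready l) :: y₂)) : G.ReadyForm (y₁ ++ y₂) := by
  generalize hs : y₁ ++ mark (ready l) :: y₂ = s at h
  cases h with
  | @finish a b l₀ h =>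
    generalize hab : a ++ b = t at h
    obtain @⟨k, ops, x₁, x₂, hk, h⟩ := h
    have h₁ := mem_of_insert (k' := ready l) hab (by rw [← hs]; simp)
    obtain rfl : k = ready l := by simpa [eq_comm] using h₁
    cases hk with
    -- A marker that has just executed an instruction has a nonempty program.
    | ready h' => simp [hl] at h'
  | @load a b l₀ p hp hl₀ h =>
    generalize hab : a ++ b = t at h
    obtain @⟨l₁, x₁, x₂, h⟩ := h
    have hne : l ≠ l₀ := by
      rintro rfl
      exact program_ne_nil hp (hl₀.symm.trans hl)
    have h₁ := mem_of_insert (k' := ready l) hab (by rw [← hs]; simp)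
    obtain rfl : l = l₁ := by simpa [hne] using h₁
    obtain ⟨z₁, z₂, hz, hy⟩ := insert_erase hab (by simpa using hne) hs.symm
    rw [hy]
    refine .mk fun y hr => ?_
    rw [hl₀, run_program] at hr
    obtain ⟨z, rfl, rfl⟩ := hr
    -- With an empty program the invariant says that the whole string is derivable; a complete run
    -- of the new program adds one application of `p`.
    exact (h x₂ (by rw [hl]; exact .nil x₂)).tail ⟨p, hp, z₁, z, by simp [← hz], by simp⟩

theorem DoneClearForm.clearDone {l : G.Remainder} {y₁ y₂}
    (h : G.DoneClearForm (y₁ ++ mark (ready l) :: mark (done l) :: y₂)) :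
    G.ReadyForm (y₁ ++ mark (ready l) :: y₂) := by
  generalize hs : y₁ ++ mark (ready l) :: mark (done l) :: y₂ = s at h
  cases h with
  | @next a b l₀ h =>
    generalize hab : a ++ b = t at h
    obtain @⟨k, ops, x₁, x₂, hk, h⟩ := h
    have h₁ := mem_of_insert (k' := done l) hab (by rw [← hs]; simp)
    have h₂ := mem_of_insert (k' := ready l) hab (by rw [← hs]; simp)
    obtain rfl : k = done l := by simpa [eq_comm] using h₁
    obtain rfl : l = l₀ := by simpa using h₂
    obtain ⟨rfl, rfl⟩ := insert_split hab (by simp) hs.symm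
    obtain ⟨-, rfl, rfl⟩ := split_unique hab.symm
    cases hk
    exact .mk h
  | @halt x h =>
    exact absurd (by simp) (by rw [hs]; exact mark_notMem (ready l) x :
      mark (ready l) ∉ y₁ ++ mark (ready l) :: mark (done l) :: y₂)

/-- The invariants quantify over all outcomes of the remaining program, hence hold vacuously when
the program cannot be completed: a badly placed load needs no separate treatment. -/
theorem SysForm.step {c d : Fin 4 × List G.SysSymbol} (hc : G.SysForm c.1 c.2)
    (h : G.SysStep c d) : G.SysForm d.1 d.2 := by
  obtain ⟨i, s⟩ := c
  obtain ⟨j, s'⟩ := d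
  obtain ⟨r, hr, h⟩ := h
  dsimp only at hr h hc ⊢
  cases hr <;> simp only [ins_applies, del_applies] at h <;> obtain ⟨y₁, y₂, rfl, rfl⟩ := h
  case insert hl => exact ReadyForm.insert hl hc
  case delete hl => exact ReadyForm.delete hl hc
  case finish l => exact ReadyClearForm.finish l hc
  case clearReady hl => exact ReadyClearForm.clearReady hl hc
  case next l => exact DoneClearForm.next l hc
  case clearDone l => exact DoneClearForm.clearDone hc
  case load hp hl => exact ReadyClearForm.load hp hl hc
  case unload hl => exact ReadyClearForm.unload hl hc
  case halt hl => exact ReadyForm.halt hl hc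

/-! ### Completeness: simulating derivations -/

theorem sysStep_ins {i j a} (h : G.SysRule i (ins [] a) j) (y₁ y₂ : List G.SysSymbol) :
    G.SysStep (i, y₁ ++ y₂) (j, y₁ ++ a :: y₂) :=
  ⟨_, h, ins_applies.2 ⟨y₁, y₂, rfl, rfl⟩⟩

theorem sysStep_del {i j a} (h : G.SysRule i (del [] a) j) (y₁ y₂ : List G.SysSymbol) :
    G.SysStep (i, y₁ ++ a :: y₂) (j, y₁ ++ y₂) :=
  ⟨_, h, del_applies.2 ⟨y₁, y₂, rfl, rfl⟩⟩

/-- Execution of the first instruction, and passing to the rest of the program. -/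
theorem sysStep_instruction {l l' : G.Remainder} {o} (h : l.1 = o :: l'.1)
    (y₁ : List G.SysSymbol) {y₂ y₃}
    (hs : G.SysStep (0, y₁ ++ mark (ready l) :: y₂) (1, y₁ ++ mark (ready l) :: y₃)) :
    ReflTransGen G.SysStep (0, y₁ ++ mark (ready l) :: y₂) (0, y₁ ++ mark (ready l') :: y₃) :=
  .head hs <| .head (sysStep_ins (.finish l') y₁ _) <|
    .head ⟨_, .clearReady h, del_applies.2 ⟨y₁, y₃, rfl, rfl⟩⟩ <|
    .head (sysStep_ins (.next l') y₁ _) <|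
    .single ⟨_, .clearDone l', del_applies.2 ⟨y₁, y₃, rfl, rfl⟩⟩

theorem reflTransGen_sysStep_run {ops x y} (h : Run ops x y) (l : G.Remainder) (hl : l.1 = ops)
    (y₁ : List G.SysSymbol) :
    ReflTransGen G.SysStep (0, y₁ ++ mark (ready l) :: emap _ x)
      (0, y₁ ++ mark (ready (Remainder.empty G)) :: emap _ y) := by
  have tail {l : G.Remainder} {o ops} (hl : l.1 = o :: ops) :
      ∃ l' : G.Remainder, l'.1 = ops := by
    refine ⟨⟨ops, .inr ?_⟩, rfl⟩
    -- Suffixes of a program are closed under removal of the first instruction.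
    rcases l.2 with h | ⟨p, hp, h⟩
    · simp [hl] at h
    · exact ⟨p, hp, (hl ▸ List.suffix_cons o ops : ops <:+ l.1).trans h⟩
  induction h generalizing l with
  | nil x =>
    obtain rfl : l = Remainder.empty G := Subtype.ext hl
    exact .refl
  | @del a ops x y h ih =>
    obtain ⟨l', rfl⟩ := tail hl
    exact (sysStep_instruction hl y₁
      ⟨_, .delete hl, del_applies.2 ⟨y₁, emap _ x, rfl, rfl⟩⟩).trans (ih l' rfl)
  | @ins a ops x y h ih =>
    obtain ⟨l', rfl⟩ := tail hl
    exact (sysStep_instruction hl y₁ (y₃ := emap _ (a :: x))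
      ⟨_, .insert hl, ins_applies.2 ⟨y₁, emap _ x, rfl, rfl⟩⟩).trans (ih l' rfl)

theorem exists_sysStep_of_generates {x : List (Symbol T G.N)} (h : G.Generates x) :
    ∃ x₁ x₂, x = x₁ ++ x₂ ∧
      ReflTransGen G.SysStep
        (0, [mark (ready (Remainder.empty G)), emb _ (.nonterminal G.start)])
        (0, emap _ x₁ ++ mark (ready (Remainder.empty G)) :: emap _ x₂) := by
  induction h with
  | refl => exact ⟨[], [_], rfl, .refl⟩
  | tail _ h ih =>
    obtain ⟨x₁, x₂, rfl, ih⟩ := ih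
    obtain ⟨p, hp, z₁, z₂, hx, rfl⟩ := h
    let l : G.Remainder := ⟨program p, .inr ⟨p, hp, List.suffix_rfl⟩⟩
    obtain ⟨a, b, y₁, y₂, hab, hy, hyy⟩ := exists_insert_erase (z₁ := z₁) (z₂ := p.1 ++ z₂)
      (ready (Remainder.empty G)) (ready l) (by simpa using hx)
    refine ⟨z₁, p.2 ++ z₂, by simp, ih.trans ?_⟩
    rw [← hab]
    refine .head (sysStep_ins (.load (l := l) hp rfl) a b) ?_
    -- The same string, now split at the old marker, which is to be erased.
    rw [show a ++ mark (ready _) :: b = _ from hy]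
    refine .head (sysStep_del (.unload rfl) y₁ y₂) ?_
    rw [hyy]
    exact reflTransGen_sysStep_run (run_program.2 ⟨z₂, rfl, rfl⟩) l rfl _

theorem toGC_language [Finite T] : G.toGC.language = G.language := by
  ext w
  change (∃ a ∈ ({[mark (ready (Remainder.empty G)), emb _ (.nonterminal G.start)]} :
    Set (List G.SysSymbol)), ReflTransGen G.SysStep (0, a) (3, w.map .terminal)) ↔
    G.Generates (w.map .terminal)
  rw [← emap_terminal (N := G.N)]
  constructor
  · rintro ⟨a, rfl, h⟩
    have key {c} (h : ReflTransGen G.SysStep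
        (0, [mark (ready (Remainder.empty G)), emb _ (.nonterminal G.start)]) c) :
        G.SysForm c.1 c.2 := by
      induction h with
      | refl =>
        refine ReadyForm.mk (x₁ := []) (x₂ := [_]) fun y hy => ?_
        cases hy
        exact .refl
      | tail _ h ih => exact ih.step h
    have hf : G.DoneClearForm _ := key h
    generalize hs : emap (Marker G.Remainder) (w.map (.terminal : T → Symbol T G.N)) = s at hf
    cases hf with
    -- Component 3 is also reached in mid-computation, but then a marker is present and the string
    -- is not terminal.
    | @next a b l h =>
      refine absurd ?_ (mark_notMem (ready l) (w.map (.terminal : T → Symbol T G.N)))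
      rw [hs]
      exact List.mem_append_right a List.mem_cons_self
    | halt h => exact emap_inj.1 hs ▸ h
  · intro h
    obtain ⟨x₁, x₂, hx, h⟩ := exists_sysStep_of_generates h
    refine ⟨_, rfl, ?_⟩
    rw [hx, emap, List.map_append]
    exact h.tail (sysStep_del (.halt rfl) _ _)

end Type0Grammar

theorem RE_subset_GCL (T : Type) [Finite T] : RE T ⊆ GCL T 4 1 1 0 1 1 0 := by
  rintro _ ⟨G, rfl⟩
  exact ⟨4, le_rfl, G.toGC, fun _ ht => Type0Grammar.SysRule.sizeLE ht, G.toGC_language⟩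

theorem theorem2 (T : Type) [Finite T] : GCL T 4 1 1 0 1 1 0 = RE T := by
  exact (GCL_subset_RE T 4 1 1 0 1 1 0).antisymm (RE_subset_GCL T)
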